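/- Fix $n\ge 1$ and write $[n]=\{1,\dots,n\}$. **Schubert matroids.** For $R,S\subseteq[n]$ write $R\le S$ if $\#R=\#S$ and, for every $m$, the $m$-th smallest element of $R$ is at most the $m$-th smallest element of $S$. For $I\subseteq[n]$ the Schubert matroid $\mathrm{SM}_n(I)$ is the matroid on $[n]$ whose bases are the sets $B\subseteq[n]$ with $B\le I$, and its rank function is $r_{\mathrm{SM}_n(I)}(J)=\max\{\#(J\cap B): B\le I\}$. **Schubitopes.** A diagram $D\subseteq[n]\times[k]$ (with $k\ge 0$ columns) is written as its list of columns $D=(D_1,\dots,D_k)$, $D_j\subseteq[n]$; for diagrams with the same number of columns, $C\le D$ means $C_j\le D_j$ for all $j$. Let $Y$ be the generic upper triangular $n\times n$ matrix with entries $y_{ij}$ for $i\le j$ and $0$ elsewhere, and let $\mathcal M_D\subseteq\mathbb C[y_{ij}:i\le j]$ be the span of the products $\prod_{j=1}^k\det(Y^{C_j}_{D_j})$ over all $C\le D$, where $Y_{D_j}^{C_j}$ is the submatrix with rows $C_j$ and columns $D_j$. An invertible upper triangular matrix $b$ acts on polynomials by $f(Y)\cdot b=f(b^{-1}Y)$.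 The dual character $\chi_D(x_1,\dots,x_n)$ is the trace of $\mathrm{diag}(x_1^{-1},\dots,x_n^{-1})$ acting on $\mathcal M_D$; it is a polynomial in $\mathbb Z[x_1,\dots,x_n]$. The Schubitope $\mathcal S_D\subset\mathbb R^n$ is the Newton polytope of $\chi_D$ (the convex hull of the exponent vectors of $\chi_D$). **Generalized permutahedra.** A function $z:2^{[n]}\to\mathbb R$ is submodular if $z(I)+z(J)\ge z(I\cup J)+z(I\cap J)$ for all $I,J\subseteq[n]$. A generalized permutahedron with associated submodular function $z$, where $z$ is submodular and $z(\emptyset)=0$, is the polytope $$P=\Big\{t\in\mathbb R^n:\ \sum_{i\in I}t_i\le z(I)\text{ for all }I\subseteq[n],\ \sum_{i=1}^n t_i=z([n])\Big\}.$$ **Theorem.** 1. The rank functions $r_{\mathrm{SM}_n(I)}$, indexed by the nonempty subsets $I\subseteq[n]$, form a basis of the real vector space of functions $f:2^{[n]}\to\mathbb R$ with $f(\emptyset)=0$. 2. Let $P\subset\mathbb R^n$ be a generalized permutahedron with associated submodular function $z$. Then $P$ is a Schubitope (that is, $P=\mathcal S_D$ for some $k$ and some diagram $D\subseteq[n]\times[k]$)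 if and only if $z$ is a linear combination of the functions $r_{\mathrm{SM}_n(I)}$, $\emptyset\ne I\subseteq[n]$, with coefficients in $\mathbb Z_{\ge0}$. 3. For diagrams $D,D'\subseteq[n]\times[k]$, $\mathcal S_D=\mathcal S_{D'}$ if and only if $D$ is obtained from $D'$ by a permutation of the columns. More generally, for $D\subseteq[n]\times[k]$ and $D'\subseteq[n]\times[k']$, $\mathcal S_D=\mathcal S_{D'}$ if and only if the nonempty columns of $D$ are, up to a permutation, the nonempty columns of $D'$. -/

import Mathlib

namespace SchubitopeTheory

/-! ### Diagrams -/

/-- A diagram `D ⊆ [n] × [k]`, recorded by its columns `D = (D_1, …, D_k)`, each a subset of `[n]`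
(the index set `Fin n` stands for `[n]`, in the same order). -/
abbrev Diagram (n k : ℕ) : Type := Fin k → Finset (Fin n)

/-- `R ≤ S`: the two sets have the same size, and the `m`-th smallest element of `R` does not
exceed the `m`-th smallest element of `S`, for every `m`. -/
def SetLE {n : ℕ} (R S : Finset (Fin n)) : Prop :=
  ∃ h : R.card = S.card, ∀ m : Fin S.card, R.orderEmbOfFin h m ≤ S.orderEmbOfFin rfl m

/-- `C ≤ D` for diagrams: columnwise comparison. -/
def DiagramLE {n k : ℕ} (C D : Diagram n k) : Prop :=
  ∀ j, SetLE (C j) (D j)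

/-! ### Flagged Weyl modules and their dual characters -/

/-- The coordinate ring `ℂ[𝔟]` of the space `𝔟` of upper triangular `n × n` matrices: the polynomial
ring in the variables `y_{ij}`, `i ≤ j`. -/
abbrev BorelRing (n : ℕ) : Type := MvPolynomial {p : Fin n × Fin n // p.1 ≤ p.2} ℂ

/-- The generic upper triangular matrix `Y`. -/
noncomputable def genericUpper (n : ℕ) : Matrix (Fin n) (Fin n) (BorelRing n) :=
  fun i j => if h : i ≤ j then MvPolynomial.X ⟨(i, j), h⟩ else 0

/-- The action `f(Y) · b = f(b⁻¹ Y)` on `ℂ[𝔟]`, for `b` invertible and upper triangular. -/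
noncomputable def borelAct {n : ℕ} (b : GL (Fin n) ℂ) : BorelRing n →ₐ[ℂ] BorelRing n :=
  MvPolynomial.aeval fun p =>
    ((((b⁻¹ : GL (Fin n) ℂ) : Matrix (Fin n) (Fin n) ℂ).map MvPolynomial.C * genericUpper n :
      Matrix (Fin n) (Fin n) (BorelRing n))) p.1.1 p.1.2

/-- The minor `det (Y_R^S)` of the generic upper triangular matrix with column set `R` and
row set `S`, both listed increasingly. -/
noncomputable def upperMinor {n : ℕ} (R S : Finset (Fin n)) (h : S.card = R.card) : BorelRing n :=
  ((genericUpper n).submatrix (S.orderEmbOfFin h) (R.orderEmbOfFin rfl)).det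

/-- The product of minors `∏_j det (Y_{D_j}^{C_j})`, for `C ≤ D`. -/
noncomputable def minorProduct {n k : ℕ} (C D : Diagram n k) (h : DiagramLE C D) : BorelRing n :=
  ∏ j, upperMinor (D j) (C j) (h j).fst

/-- The flagged Weyl module `M_D ⊆ ℂ[𝔟]`. -/
noncomputable def flaggedWeylModule {n k : ℕ} (D : Diagram n k) : Submodule ℂ (BorelRing n) :=
  Submodule.span ℂ {f | ∃ (C : Diagram n k) (h : DiagramLE C D), f = minorProduct C D h}

/-- The diagonal matrix `diag(x_1, …, x_n)` of the torus `T`. -/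
def torusElt {n : ℕ} (x : Fin n → ℂˣ) : GL (Fin n) ℂ where
  val := Matrix.diagonal fun i => (x i : ℂ)
  inv := Matrix.diagonal fun i => ((x i)⁻¹ : ℂˣ)
  val_inv := by simp
  inv_val := by simp

theorem genericUpper_act {n : ℕ} (x : Fin n → ℂˣ) (i j : Fin n) :
    borelAct (torusElt x⁻¹) (genericUpper n i j) =
      MvPolynomial.C (x i : ℂ) * genericUpper n i j := by
  have hinv : (((torusElt x⁻¹)⁻¹ : GL (Fin n) ℂ) : Matrix (Fin n) (Fin n) ℂ) =
      Matrix.diagonal fun i => (x i : ℂ) := by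
    change Matrix.diagonal (fun i => (((x⁻¹ : Fin n → ℂˣ) i)⁻¹ : ℂˣ).val) = _
    simp
  by_cases h : i ≤ j
  · have : genericUpper n i j = MvPolynomial.X ⟨(i, j), h⟩ := by simp [genericUpper, h]
    rw [this, borelAct, MvPolynomial.aeval_X, hinv, Matrix.diagonal_map (by simp),
      Matrix.diagonal_mul, this]
  · simp [genericUpper, h]

theorem upperMinor_act {n : ℕ} (x : Fin n → ℂˣ) (R S : Finset (Fin n)) (h : S.card = R.card) :
    borelAct (torusElt x⁻¹) (upperMinor R S h) =
      MvPolynomial.C (∏ i ∈ S, (x i : ℂ)) * upperMinor R S h := by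
  have hprod : ∏ i ∈ S, (x i : ℂ) = ∏ m, (x (S.orderEmbOfFin h m) : ℂ) := by
    conv_lhs => rw [← Finset.map_orderEmbOfFin_univ S h]
    rw [Finset.prod_map]
    rfl
  rw [upperMinor, AlgHom.map_det, hprod, map_prod, ← Matrix.det_mul_column]
  congr 1
  ext a b : 2
  simp [genericUpper_act]

theorem minorProduct_act {n k : ℕ} (x : Fin n → ℂˣ) (C D : Diagram n k) (h : DiagramLE C D) :
    borelAct (torusElt x⁻¹) (minorProduct C D h) =
      (∏ j, ∏ i ∈ C j, (x i : ℂ)) • minorProduct C D h := by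
  rw [minorProduct, map_prod, MvPolynomial.smul_eq_C_mul, map_prod, ← Finset.prod_mul_distrib]
  exact Finset.prod_congr rfl fun j _ => upperMinor_act x _ _ _

/-- The flagged Weyl module is stable under the torus. -/
theorem flaggedWeylModule_stable {n k : ℕ} (D : Diagram n k) (x : Fin n → ℂˣ) :
    ∀ f ∈ flaggedWeylModule D,
      (borelAct (torusElt x⁻¹)).toLinearMap f ∈ flaggedWeylModule D := by
  intro f hf
  induction hf using Submodule.span_induction with
  | mem f hf =>
    obtain ⟨C, h, rfl⟩ := hf
    rw [AlgHom.toLinearMap_apply, minorProduct_act]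
    exact Submodule.smul_mem _ _ (Submodule.subset_span ⟨C, h, rfl⟩)
  | zero => simp
  | add f g _ _ hf hg => rw [map_add]; exact Submodule.add_mem _ hf hg
  | smul c f _ hf => rw [map_smul]; exact Submodule.smul_mem _ _ hf

/-- The dual character `χ_D` of the flagged Weyl module, a function on the torus: its value at
`diag(x_1, …, x_n)` is the trace of `diag(x_1⁻¹, …, x_n⁻¹)` acting on `M_D`. -/
noncomputable def dualCharacter {n k : ℕ} (D : Diagram n k) (x : Fin n → ℂˣ) : ℂ :=
  LinearMap.trace ℂ (flaggedWeylModule D)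
    ((borelAct (torusElt x⁻¹)).toLinearMap.restrict (flaggedWeylModule_stable D x))

/-- The dual character is given by a polynomial with integer coefficients. -/
theorem exists_dualCharacter_eq {n k : ℕ} (D : Diagram n k) :
    ∃ p : MvPolynomial (Fin n) ℤ, ∀ x : Fin n → ℂˣ,
      MvPolynomial.aeval (fun i => (x i : ℂ)) p = dualCharacter D x := by
  classical
  obtain ⟨b, hbs, hspan, hli⟩ := exists_linearIndependent ℂ
    {f | ∃ (C : Diagram n k) (h : DiagramLE C D), f = minorProduct C D h}
  have hfin : b.Finite := by
    refine Set.Finite.subset ?_ hbs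
    refine (Set.finite_range fun C : Diagram n k =>
      if h : DiagramLE C D then minorProduct C D h else 0).subset ?_
    rintro f ⟨C, h, rfl⟩
    exact ⟨C, by simp [h]⟩
  have : Fintype b := hfin.fintype
  choose C hC hCeq using hbs
  let B : Module.Basis b ℂ (flaggedWeylModule D) :=
    (Module.Basis.span hli).map
      (LinearEquiv.ofEq _ _ (by rw [Subtype.range_coe]; exact hspan))
  have hB : ∀ v : b, ((B v : flaggedWeylModule D) : BorelRing n) = v := by
    intro v
    simp [B, Module.Basis.span_apply]
  refine ⟨∑ v : b, ∏ j, ∏ i ∈ C v.2 j, MvPolynomial.X i, fun x => ?_⟩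
  rw [dualCharacter, LinearMap.trace_eq_matrix_trace ℂ B, Matrix.trace, map_sum]
  refine Finset.sum_congr rfl fun v _ => ?_
  have hact : (borelAct (torusElt x⁻¹)).toLinearMap.restrict (flaggedWeylModule_stable D x) (B v) =
      (∏ j, ∏ i ∈ C v.2 j, (x i : ℂ)) • B v := by
    apply Subtype.ext
    rw [Submodule.coe_smul, hB]
    change borelAct _ ((B v : flaggedWeylModule D) : BorelRing n) = _
    rw [hB]
    have h1 := minorProduct_act x (C v.2) D (hC v.2)
    rwa [← hCeq v.2] at h1
  rw [Matrix.diag_apply, LinearMap.toMatrix_apply, hact]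
  simp

/-- The polynomial `χ_D`. -/
noncomputable def dualCharacterPoly {n k : ℕ} (D : Diagram n k) : MvPolynomial (Fin n) ℤ :=
  Classical.choose (exists_dualCharacter_eq D)

theorem dualCharacterPoly_unique {n k : ℕ} (D : Diagram n k) (p : MvPolynomial (Fin n) ℤ)
    (hp : ∀ x : Fin n → ℂˣ, MvPolynomial.aeval (fun i => (x i : ℂ)) p = dualCharacter D x) :
    p = dualCharacterPoly D := by
  apply MvPolynomial.map_injective (Int.castRingHom ℂ) Int.cast_injective
  refine MvPolynomial.funext_set (fun _ => {0}ᶜ) (fun _ => (Set.finite_singleton 0).infinite_compl)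
    fun x hx => ?_
  have hx0 : ∀ i, x i ≠ 0 := fun i => hx i trivial
  have h1 := (hp fun i => Units.mk0 (x i) (hx0 i)).trans
    (Classical.choose_spec (exists_dualCharacter_eq D) fun i => Units.mk0 (x i) (hx0 i)).symm
  rw [MvPolynomial.eval_map, MvPolynomial.eval_map]
  exact h1

/-- The Newton polytope of a polynomial: the convex hull in `ℝⁿ` of its exponent vectors. -/
def newtonPolytope {n : ℕ} (p : MvPolynomial (Fin n) ℤ) : Set (Fin n → ℝ) :=
  convexHull ℝ ((fun (α : Fin n →₀ ℕ) (i : Fin n) => (α i : ℝ)) '' (p.support : Set (Fin n →₀ ℕ)))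

/-- The Schubitope of a diagram: the Newton polytope of its dual character. -/
noncomputable def schubitope {n k : ℕ} (D : Diagram n k) : Set (Fin n → ℝ) :=
  newtonPolytope (dualCharacterPoly D)

/-- A subset of `ℝⁿ` is a Schubitope if it is the Schubitope of a diagram `D ⊆ [n] × [k]`, for
some number `k` of columns. -/
def IsSchubitope {n : ℕ} (P : Set (Fin n → ℝ)) : Prop :=
  ∃ (k : ℕ) (D : Diagram n k), P = schubitope D

/-! ### Generalized permutahedra -/

/-- Submodularity of a set function `z : 2^[n] → ℝ`. -/
def IsSubmodular {n : ℕ} (z : Finset (Fin n) → ℝ) : Prop :=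
  ∀ I J, z (I ∪ J) + z (I ∩ J) ≤ z I + z J

/-- `P` is the generalized permutahedron whose associated submodular function is `z`. -/
def IsGeneralizedPermutahedronOf {n : ℕ} (P : Set (Fin n → ℝ)) (z : Finset (Fin n) → ℝ) : Prop :=
  IsSubmodular z ∧ z ∅ = 0 ∧
    P = {t | (∀ I : Finset (Fin n), ∑ i ∈ I, t i ≤ z I) ∧ ∑ i, t i = z Finset.univ}

/-! ### Schubert matroids -/

theorem setLE_iff {n : ℕ} (R S : Finset (Fin n)) :
    SetLE R S ↔ R.card = S.card ∧
      ∀ t, (R.filter (t ≤ ·)).card ≤ (S.filter (t ≤ ·)).card := by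
  have key : ∀ (A : Finset (Fin n)) (m : ℕ) (h : A.card = m) (t : Fin n),
      (A.filter (t ≤ ·)).card =
        (Finset.univ.filter fun i : Fin m => t ≤ A.orderEmbOfFin h i).card := by
    intro A m h t
    conv_lhs => rw [← Finset.map_orderEmbOfFin_univ A h]
    rw [Finset.filter_map, Finset.card_map]
    rfl
  constructor
  · rintro ⟨h, hle⟩
    refine ⟨h, fun t => ?_⟩
    rw [key R _ h, key S _ rfl]
    refine Finset.card_le_card fun i hi => ?_
    simp only [Finset.mem_filter, Finset.mem_univ, true_and] at hi ⊢
    exact hi.trans (hle i)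
  · rintro ⟨h, hle⟩
    refine ⟨h, fun m => ?_⟩
    by_contra! hlt
    have h1 := hle (R.orderEmbOfFin h m)
    rw [key R _ h, key S _ rfl] at h1
    refine absurd h1 (not_le.2 (Finset.card_lt_card ?_))
    refine Finset.ssubset_iff_subset_ne.2 ⟨fun i hi => ?_, fun he => ?_⟩
    · simp only [Finset.mem_filter, Finset.mem_univ, true_and, OrderEmbedding.le_iff_le] at hi ⊢
      have h2 := hlt.trans_le hi
      exact ((OrderEmbedding.lt_iff_lt _).1 h2).le
    · have hm : m ∈ Finset.univ.filter
          (fun i => R.orderEmbOfFin h m ≤ R.orderEmbOfFin h i) := by simp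
      rw [← he] at hm
      simp only [Finset.mem_filter, Finset.mem_univ, true_and] at hm
      exact absurd hm (not_le.2 hlt)

theorem setLE_exchange {n : ℕ} {I X Y : Finset (Fin n)} (hX : SetLE X I) (hY : SetLE Y I)
    {a : Fin n} (haX : a ∈ X) (haY : a ∉ Y) :
    ∃ b, b ∈ Y ∧ b ∉ X ∧ SetLE (insert b (X.erase a)) I := by
  rw [setLE_iff] at hX hY
  have hcard : X.card = Y.card := hX.1.trans hY.1.symm
  have hne : (Y \ X).Nonempty := by
    rw [Finset.nonempty_iff_ne_empty, Ne, Finset.sdiff_eq_empty_iff_subset]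
    intro hYX
    exact haY (Finset.eq_of_subset_of_card_le hYX hcard.le ▸ haX)
  obtain ⟨b, hb, hmin⟩ := (Y \ X).exists_min_image id hne
  rw [Finset.mem_sdiff] at hb
  refine ⟨b, hb.1, hb.2, ?_⟩
  have hbe : b ∉ X.erase a := fun h => hb.2 (Finset.mem_of_mem_erase h)
  have hpos : 0 < X.card := Finset.card_pos.2 ⟨a, haX⟩
  rw [setLE_iff]
  refine ⟨by rw [Finset.card_insert_of_notMem hbe, Finset.card_erase_of_mem haX]; omega,
    fun t => ?_⟩
  rw [Finset.filter_insert, Finset.filter_erase]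
  have hbe' : b ∉ (X.filter (t ≤ ·)).erase a := fun h =>
    hb.2 (Finset.mem_filter.1 (Finset.mem_of_mem_erase h)).1
  split_ifs with htb
  · rw [Finset.card_insert_of_notMem hbe']
    by_cases hta : t ≤ a
    · have hmem : a ∈ X.filter (t ≤ ·) := Finset.mem_filter.2 ⟨haX, hta⟩
      rw [Finset.card_erase_add_one hmem]
      exact hX.2 t
    · have hsub : Y.filter (fun i => ¬ t ≤ i) ⊂ X.filter (fun i => ¬ t ≤ i) := by
        rw [Finset.ssubset_iff_of_subset]
        · exact ⟨a, by simp [haX, not_le.1 hta], by simp [haY]⟩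
        · intro y hy
          rw [Finset.mem_filter] at hy ⊢
          refine ⟨?_, hy.2⟩
          by_contra hyX
          exact hy.2 (htb.trans (hmin y (Finset.mem_sdiff.2 ⟨hy.1, hyX⟩)))
      have h1 := Finset.card_lt_card hsub
      have h2 := X.card_filter_add_card_filter_not (t ≤ ·)
      have h3 := Y.card_filter_add_card_filter_not (t ≤ ·)
      have h4 := hY.2 t
      have h5 := Finset.card_erase_le (s := X.filter (t ≤ ·)) (a := a)
      omega
  · exact Finset.card_erase_le.trans (hX.2 t)

/-- The Schubert matroid `SM_n(I)`, `I = {s_1 < … < s_r}`: its ground set is `[n]` and its bases are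
the sets `{a_1 < … < a_r}` with `a_1 ≤ s_1, …, a_r ≤ s_r`. -/
noncomputable def schubertMatroid (n : ℕ) (I : Finset (Fin n)) : Matroid (Fin n) :=
  Matroid.ofIsBaseOfFinite (E := Set.univ) Set.finite_univ
    (fun B => ∃ A : Finset (Fin n), (A : Set (Fin n)) = B ∧ SetLE A I)
    ⟨I, I, rfl, rfl, fun _ => le_rfl⟩
    (by
      rintro _ _ ⟨X, rfl, hX⟩ ⟨Y, rfl, hY⟩ a ⟨haX, haY⟩
      obtain ⟨b, hbY, hbX, hb⟩ := setLE_exchange hX hY haX haY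
      exact ⟨b, ⟨hbY, hbX⟩, _, by simp, hb⟩)
    (fun _ _ => Set.subset_univ _)

open Classical in
/-- The rank function of a matroid on `[n]`: `r_M(S) = max {#(S ∩ B) : B a basis of M}`. -/
noncomputable def matroidRank {n : ℕ} (M : Matroid (Fin n)) (S : Finset (Fin n)) : ℕ :=
  (Finset.univ.filter fun B : Finset (Fin n) => M.IsBase (B : Set (Fin n))).sup
    fun B => (S ∩ B).card

/-- `matroidRank` agrees with the usual rank of a set in a matroid. -/
theorem matroidRank_eq_eRk {n : ℕ} (M : Matroid (Fin n)) (S : Finset (Fin n)) (hM : M.E = Set.univ) :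
    (matroidRank M S : ℕ∞) = M.eRk S := by
  classical
  apply le_antisymm
  · rw [matroidRank]
    obtain ⟨B₀, hB₀⟩ := M.exists_isBase
    obtain ⟨B, hB, hsup⟩ := Finset.exists_mem_eq_sup
      (Finset.univ.filter fun B : Finset (Fin n) => M.IsBase (B : Set (Fin n)))
      ⟨B₀.toFinset, by simpa using hB₀⟩ (fun B => (S ∩ B).card)
    have hB' : M.IsBase (B : Set (Fin n)) := by simpa using hB
    have hind : M.Indep ((S ∩ B : Finset (Fin n)) : Set (Fin n)) :=
      hB'.indep.subset (by simp)
    have := hind.encard_le_eRk_of_subset (X := (S : Set (Fin n))) (by simp)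
    rw [Set.encard_coe_eq_coe_finsetCard] at this
    refine le_trans (le_of_eq ?_) this
    rw [← hsup]
  · obtain ⟨J, hJ⟩ := M.exists_isBasis (S : Set (Fin n)) (by simp [hM])
    obtain ⟨B, hB, hJB⟩ := hJ.indep.exists_isBase_superset
    rw [← hJ.encard_eq_eRk]
    have h1 : J ⊆ ((S ∩ B.toFinset : Finset (Fin n)) : Set (Fin n)) := by
      simpa using ⟨hJ.subset, hJB⟩
    refine (Set.encard_le_encard h1).trans ?_
    rw [Set.encard_coe_eq_coe_finsetCard, Nat.cast_le, matroidRank]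
    exact Finset.le_sup (f := fun B => (S ∩ B).card) (by simpa using hB)

/-- The rank function of the Schubert matroid `SM_n(I)`, as a function `2^[n] → ℝ`. -/
noncomputable def schubertRank {n : ℕ} (I : Finset (Fin n)) : Finset (Fin n) → ℝ :=
  fun J => (matroidRank (schubertMatroid n I) J : ℝ)

/-- The space of functions `f : 2^[n] → ℝ` with `f(∅) = 0`. -/
def pointedSetFunctions (n : ℕ) : Submodule ℝ (Finset (Fin n) → ℝ) where
  carrier := {f | f ∅ = 0}
  add_mem' := by
    intro f g hf hg
    simp_all
  zero_mem' := rfl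
  smul_mem' := by
    intro c f hf
    simp_all

end SchubitopeTheory

open SchubitopeTheory

namespace SchubitopeTheory

/-! ### Rank functions of Schubert matroids -/

/-! Each product of minors is a nonzero weight vector for the torus, so the exponents of `χ_D` are
exactly the row weights of the diagrams `C ≤ D`. The columns of `C` vary independently over the
bases of the Schubert matroids of the `D_j`. Hence `S_D` is cut out by the sum of the column rank
functions (`schubitope_eq_basePolytope`, by a greedy argument and separation). A submodular `z` is
recovered from its polytope, since every bound `t(I) ≤ z(I)` is attained (`eq_of_basePolytope_eq`).
So all the statements about Schubitopes reduce to linear independence of the rank functions.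

Independence is triangularity. For `J` with maximum `m`, consider the functional `f ↦ f(J ∪ (m, n])
- f((J \ m) ∪ (m, n])`. It is nonzero on the rank function of `J`; if it is nonzero on that of `I`,
then `J ⊆ B` for some `B ≤ I`. In the latter case the element sum of `J` is at most that of `I`,
with equality only for `I = J`. A dimension count then gives the basis. -/

theorem setLE_refl {n : ℕ} (I : Finset (Fin n)) : SetLE I I :=
  ⟨rfl, fun _ => le_rfl⟩

theorem schubertMatroid_isBase_iff {n : ℕ} (I B : Finset (Fin n)) :
    (schubertMatroid n I).IsBase (B : Set (Fin n)) ↔ SetLE B I := by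
  change (∃ A : Finset (Fin n), (A : Set (Fin n)) = B ∧ SetLE A I) ↔ _
  simp

theorem card_inter_le_matroidRank {n : ℕ} {I B : Finset (Fin n)} (hB : SetLE B I)
    (J : Finset (Fin n)) : (J ∩ B).card ≤ matroidRank (schubertMatroid n I) J := by
  classical
  rw [matroidRank]
  convert Finset.le_sup (f := fun B => (J ∩ B).card) (b := B) ?_
  simpa [schubertMatroid_isBase_iff] using hB

theorem exists_card_inter_eq_matroidRank {n : ℕ} (I J : Finset (Fin n)) :
    ∃ B, SetLE B I ∧ (J ∩ B).card = matroidRank (schubertMatroid n I) J := by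
  classical
  obtain ⟨B, hB, h⟩ := Finset.exists_mem_eq_sup
    (Finset.univ.filter fun B : Finset (Fin n) => (schubertMatroid n I).IsBase (B : Set (Fin n)))
    ⟨I, by simpa [schubertMatroid_isBase_iff] using setLE_refl I⟩ (fun B => (J ∩ B).card)
  refine ⟨B, by simpa [schubertMatroid_isBase_iff] using hB, ?_⟩
  rw [matroidRank, ← h]

theorem card_inter_le_schubertRank {n : ℕ} {I B : Finset (Fin n)} (hB : SetLE B I)
    (J : Finset (Fin n)) : ((J ∩ B).card : ℝ) ≤ schubertRank I J :=
  Nat.cast_le.2 (card_inter_le_matroidRank hB J)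

theorem exists_card_inter_eq_schubertRank {n : ℕ} (I J : Finset (Fin n)) :
    ∃ B, SetLE B I ∧ ((J ∩ B).card : ℝ) = schubertRank I J := by
  obtain ⟨B, hB, h⟩ := exists_card_inter_eq_matroidRank I J
  exact ⟨B, hB, congrArg _ h⟩

theorem schubertRank_apply_empty {n : ℕ} (I : Finset (Fin n)) : schubertRank I ∅ = 0 := by
  obtain ⟨B, -, h⟩ := exists_card_inter_eq_schubertRank I ∅
  simpa using h.symm

theorem schubertRank_empty {n : ℕ} : schubertRank (∅ : Finset (Fin n)) = 0 := by
  ext J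
  obtain ⟨B, hB, h⟩ := exists_card_inter_eq_schubertRank ∅ J
  have : B = ∅ := Finset.card_eq_zero.1 hB.fst
  simpa [this] using h.symm

theorem schubertRank_univ {n : ℕ} (I : Finset (Fin n)) :
    schubertRank I Finset.univ = I.card := by
  obtain ⟨B, hB, h⟩ := exists_card_inter_eq_schubertRank I Finset.univ
  rw [← h, Finset.univ_inter, hB.fst]

/-- Lowering an element of a set `≤ I` gives a set `≤ I`. -/
theorem SetLE.insert_erase {n : ℕ} {B I : Finset (Fin n)} (h : SetLE B I) {x m : Fin n}
    (hm : m ∈ B) (hx : x ∉ B) (hxm : x ≤ m) : SetLE (insert x (B.erase m)) I := by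
  have hxe : ∀ C ⊆ B, x ∉ C.erase m := fun C hC hc => hx (hC (Finset.mem_of_mem_erase hc))
  rw [setLE_iff] at h ⊢
  refine ⟨by rw [Finset.card_insert_of_notMem (hxe _ subset_rfl), Finset.card_erase_add_one hm,
    h.1], fun t => ?_⟩
  rw [Finset.filter_insert, Finset.filter_erase]
  split_ifs with htx
  · rw [Finset.card_insert_of_notMem (hxe _ (Finset.filter_subset _ _)),
      Finset.card_erase_add_one (Finset.mem_filter.2 ⟨hm, htx.trans hxm⟩)]
    exact h.2 t
  · exact Finset.card_erase_le.trans (h.2 t)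

/-- The sum of the (one-based) elements of a set, monotone for `SetLE` and for inclusion. -/
def elementSum {n : ℕ} (I : Finset (Fin n)) : ℕ := ∑ i ∈ I, ((i : ℕ) + 1)

theorem elementSum_eq_sum_orderEmbOfFin {n k : ℕ} (I : Finset (Fin n)) (h : I.card = k) :
    elementSum I = ∑ m : Fin k, ((I.orderEmbOfFin h m : ℕ) + 1) := by
  conv_lhs => rw [elementSum, ← Finset.map_orderEmbOfFin_univ I h]
  rw [Finset.sum_map]
  rfl

theorem SetLE.elementSum_le {n : ℕ} {R S : Finset (Fin n)} (h : SetLE R S) :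
    elementSum R ≤ elementSum S := by
  obtain ⟨hc, hle⟩ := h
  rw [elementSum_eq_sum_orderEmbOfFin R hc, elementSum_eq_sum_orderEmbOfFin S rfl]
  exact Finset.sum_le_sum fun m _ => Nat.succ_le_succ (hle m)

theorem SetLE.eq_of_elementSum_le {n : ℕ} {R S : Finset (Fin n)} (h : SetLE R S)
    (hs : elementSum S ≤ elementSum R) : R = S := by
  have hs' := le_antisymm h.elementSum_le hs
  obtain ⟨hc, hle⟩ := h
  rw [elementSum_eq_sum_orderEmbOfFin R hc, elementSum_eq_sum_orderEmbOfFin S rfl,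
    Finset.sum_eq_sum_iff_of_le fun m _ => Nat.succ_le_succ (hle m)] at hs'
  refine (Finset.image_orderEmbOfFin_univ R hc).symm.trans
    (Eq.trans ?_ (Finset.image_orderEmbOfFin_univ S rfl))
  exact Finset.image_congr fun m hm => Fin.ext (Nat.succ_injective (hs' m (Finset.mem_univ m)))

theorem elementSum_mono {n : ℕ} {R S : Finset (Fin n)} (h : R ⊆ S) :
    elementSum R ≤ elementSum S :=
  Finset.sum_le_sum_of_subset h

theorem eq_of_subset_of_elementSum_le {n : ℕ} {R S : Finset (Fin n)} (h : R ⊆ S)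
    (hs : elementSum S ≤ elementSum R) : R = S := by
  by_contra hne
  obtain ⟨x, hxS, hxR⟩ := Finset.exists_of_ssubset (h.ssubset_of_ne hne)
  exact absurd hs (not_le.2 (Finset.sum_lt_sum_of_subset h hxS hxR (Nat.succ_pos _)
    fun _ _ _ => Nat.zero_le _))

/-- If the maximum `m` of `J` adds to the rank of `(J \ {m}) ∪ {m + 1, …, n}`, then `J` is
independent in the Schubert matroid. -/
theorem exists_setLE_of_schubertRank_ne {n : ℕ} {I J : Finset (Fin n)} {m : Fin n} (hmJ : m ∈ J)
    (hmax : ∀ j ∈ J, j ≤ m)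
    (h : schubertRank I (J ∪ Finset.Ioi m) ≠ schubertRank I (J.erase m ∪ Finset.Ioi m)) :
    ∃ B, SetLE B I ∧ J ⊆ B := by
  obtain ⟨B, hB, hBr⟩ := exists_card_inter_eq_matroidRank I (J ∪ Finset.Ioi m)
  have hK : J ∪ Finset.Ioi m = insert m (J.erase m ∪ Finset.Ioi m) := by
    rw [← Finset.insert_union, Finset.insert_erase hmJ]
  have hmK : m ∉ J.erase m ∪ Finset.Ioi m := by simp
  have hlt : ∀ B', SetLE B' I →
      ((J.erase m ∪ Finset.Ioi m) ∩ B').card < ((J ∪ Finset.Ioi m) ∩ B).card := by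
    intro B' hB'
    refine (card_inter_le_matroidRank hB' _).trans_lt (hBr ▸ lt_of_le_of_ne ?_ ?_)
    · obtain ⟨B'', hB'', h2⟩ := exists_card_inter_eq_matroidRank I (J.erase m ∪ Finset.Ioi m)
      rw [← h2]
      refine le_trans (Finset.card_le_card (Finset.inter_subset_inter_right ?_))
        (card_inter_le_matroidRank hB'' _)
      rw [hK]
      exact Finset.subset_insert _ _
    · exact fun he => h (congrArg Nat.cast he.symm)
  have hmB : m ∈ B := by
    by_contra hmB
    refine (hlt B hB).ne ?_
    rw [hK, Finset.insert_inter_of_notMem hmB]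
  -- If `x ∈ J` were missing from `B`, replacing `m` by the smaller `x` would give another base. It
  -- would meet the set without `m` in as many elements as `B` meets the whole set, against `hlt`.
  refine ⟨B, hB, fun x hxJ => ?_⟩
  by_contra hxB
  have hxm : x ≠ m := fun he => hxB (he ▸ hmB)
  refine (hlt _ (hB.insert_erase hmB hxB (hmax x hxJ))).ne ?_
  have hxK : x ∈ J.erase m ∪ Finset.Ioi m := by simp [hxm, hxJ]
  rw [hK, Finset.insert_inter_of_mem hmB, Finset.inter_insert_of_mem hxK,
    Finset.card_insert_of_notMem (by simp [hxB]), Finset.card_insert_of_notMem (by simp)]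
  congr 2
  ext y
  simp only [Finset.mem_inter, Finset.mem_erase]
  exact ⟨fun hy => ⟨hy.1, hy.2.2⟩, fun hy => ⟨hy.1, fun he => hmK (he ▸ hy.1), hy.2⟩⟩

/-- The maximum of `I` adds to the rank. -/
theorem schubertRank_max_ne {n : ℕ} {I : Finset (Fin n)} {m : Fin n} (hmI : m ∈ I)
    (hmax : ∀ i ∈ I, i ≤ m) :
    schubertRank I (I ∪ Finset.Ioi m) ≠ schubertRank I (I.erase m ∪ Finset.Ioi m) := by
  obtain ⟨B, hB, h⟩ := exists_card_inter_eq_schubertRank I (I.erase m ∪ Finset.Ioi m)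
  have h1 := card_inter_le_schubertRank (setLE_refl I) (I ∪ Finset.Ioi m)
  rw [Finset.inter_eq_right.2 Finset.subset_union_left] at h1
  refine ne_of_gt (lt_of_lt_of_le ?_ h1)
  rw [← h, Nat.cast_lt, ← Finset.card_erase_add_one hmI, Nat.lt_succ_iff]
  refine Finset.card_le_card fun y hy => ?_
  rw [Finset.mem_inter, Finset.mem_union] at hy
  -- A set `B ≤ I` has no element above `m = max I`, so the tail contributes nothing and the
  -- intersection lies in `I.erase m`.
  refine hy.1.resolve_right fun hym => ?_
  obtain ⟨hc, hle⟩ := hB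
  have hyB : y ∈ Finset.image (B.orderEmbOfFin hc) Finset.univ := by
    rw [Finset.image_orderEmbOfFin_univ]
    exact hy.2
  obtain ⟨a, -, rfl⟩ := Finset.mem_image.1 hyB
  exact absurd ((hle a).trans (hmax _ (Finset.orderEmbOfFin_mem _ _ _)))
    (not_le.2 (Finset.mem_Ioi.1 hym))

/-! ### Triangularity and the basis of rank functions -/

theorem linearIndependent_schubertRank (n : ℕ) :
    LinearIndependent ℝ fun I : {I : Finset (Fin n) // I.Nonempty} => schubertRank I.1 := by
  classical
  rw [Fintype.linearIndependent_iff]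
  intro c hc
  by_contra! hne
  -- With `J` of largest element sum among the nonzero coefficients, only the term of `J` survives
  -- the test functional.
  obtain ⟨J, hJ, hJmax⟩ := (Finset.univ.filter fun J => c J ≠ 0).exists_max_image
    (fun J => elementSum J.1) (hne.imp fun J hJ => by simpa using hJ)
  simp only [Finset.mem_filter, Finset.mem_univ, true_and] at hJ hJmax
  have hmax : ∀ j ∈ J.1, j ≤ J.1.max' J.2 := fun j hj => Finset.le_max' _ _ hj
  set m := J.1.max' J.2
  have hm : m ∈ J.1 := Finset.max'_mem _ _
  have key : ∑ I, c I * (schubertRank I.1 (J.1 ∪ Finset.Ioi m) -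
      schubertRank I.1 (J.1.erase m ∪ Finset.Ioi m)) = 0 := by
    have h1 := congrFun hc (J.1 ∪ Finset.Ioi m)
    have h2 := congrFun hc (J.1.erase m ∪ Finset.Ioi m)
    simp only [Finset.sum_apply, Pi.smul_apply, smul_eq_mul, Pi.zero_apply] at h1 h2
    simp only [mul_sub, Finset.sum_sub_distrib, h1, h2, sub_zero]
  rw [Fintype.sum_eq_single J] at key
  · exact (mul_ne_zero hJ (sub_ne_zero.2 (schubertRank_max_ne hm hmax))) key
  · intro I hIJ
    by_contra h0
    obtain ⟨hcI, hr⟩ := mul_ne_zero_iff.1 h0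
    obtain ⟨B, hB, hJB⟩ := exists_setLE_of_schubertRank_ne hm hmax (sub_ne_zero.1 hr)
    have hIJs := hJmax I hcI
    have h1 := hB.eq_of_elementSum_le (hIJs.trans (elementSum_mono hJB))
    subst h1
    exact hIJ (Subtype.ext (eq_of_subset_of_elementSum_le hJB hIJs).symm)

theorem finrank_pointedSetFunctions (n : ℕ) :
    Module.finrank ℝ (pointedSetFunctions n) =
      Fintype.card {I : Finset (Fin n) // I.Nonempty} := by
  classical
  let e : pointedSetFunctions n ≃ₗ[ℝ] ({I : Finset (Fin n) // I.Nonempty} → ℝ) :=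
    { toFun := fun f I => f.1 I.1
      map_add' := fun _ _ => rfl
      map_smul' := fun _ _ => rfl
      invFun := fun g => ⟨fun I => if h : I.Nonempty then g ⟨I, h⟩ else 0, by
        change dite _ _ _ = _
        simp⟩
      left_inv := by
        intro f
        ext I
        rcases I.eq_empty_or_nonempty with rfl | h
        · simpa using (show f.1 ∅ = 0 from f.2).symm
        · simp [h]
      right_inv := by
        intro g
        ext I
        simp [I.2] }
  rw [e.finrank_eq, Module.finrank_fintype_fun_eq_card]

theorem exists_basis_schubertRank (n : ℕ) :
    ∃ b : Module.Basis {I : Finset (Fin n) // I.Nonempty} ℝ (pointedSetFunctions n),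
      ∀ I, (b I : Finset (Fin n) → ℝ) = schubertRank I.1 := by
  let v : {I : Finset (Fin n) // I.Nonempty} → pointedSetFunctions n :=
    fun I => ⟨schubertRank I.1, schubertRank_apply_empty I.1⟩
  have hv : LinearIndependent ℝ v :=
    LinearIndependent.of_comp (pointedSetFunctions n).subtype (linearIndependent_schubertRank n)
  have hspan : ⊤ ≤ Submodule.span ℝ (Set.range v) := by
    rw [hv.span_eq_top_of_card_eq_finrank' (finrank_pointedSetFunctions n).symm]
  exact ⟨Module.Basis.mk hv hspan, fun I => by rw [Module.Basis.mk_apply]⟩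


/-! ### Exponent vectors of the dual character -/

/-- The exponent vector recording how often each row occurs in a diagram. -/
noncomputable def rowWeight {n k : ℕ} (C : Diagram n k) : Fin n →₀ ℕ :=
  ∑ j, ∑ i ∈ C j, Finsupp.single i 1

theorem rowWeight_apply {n k : ℕ} (C : Diagram n k) (i : Fin n) :
    rowWeight C i = ∑ j, if i ∈ C j then 1 else 0 := by
  classical
  simp [rowWeight, Finsupp.finsetSum_apply, Finsupp.single_apply]

/-- The grading of `ℂ[𝔟]` by rows. -/
noncomputable def rowGrading (n : ℕ) (p : {p : Fin n × Fin n // p.1 ≤ p.2}) : Fin n →₀ ℕ :=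
  Finsupp.single p.1.1 1

section

open MvPolynomial

theorem genericUpper_isWeightedHomogeneous {n : ℕ} (i j : Fin n) :
    IsWeightedHomogeneous (rowGrading n) (genericUpper n i j) (Finsupp.single i 1) := by
  rw [genericUpper]
  split_ifs with h
  · exact isWeightedHomogeneous_X ℂ (rowGrading n) ⟨(i, j), h⟩
  · exact isWeightedHomogeneous_zero ℂ _ _

/-- Each term of the Leibniz expansion takes one entry from every row in `S`. -/
theorem upperMinor_isWeightedHomogeneous {n : ℕ} (R S : Finset (Fin n)) (h : S.card = R.card) :
    IsWeightedHomogeneous (rowGrading n) (upperMinor R S h) (∑ i ∈ S, Finsupp.single i 1) := by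
  have hS : ∑ i ∈ S, Finsupp.single i (1 : ℕ) = ∑ m, Finsupp.single (S.orderEmbOfFin h m) 1 := by
    conv_lhs => rw [← Finset.map_orderEmbOfFin_univ S h]
    rw [Finset.sum_map]
    rfl
  rw [upperMinor, Matrix.det_apply, ← mem_weightedHomogeneousSubmodule]
  refine Submodule.sum_mem _ fun σ _ => ?_
  rw [Units.smul_def, ← Int.cast_smul_eq_zsmul ℂ]
  refine Submodule.smul_mem _ _ ?_
  rw [mem_weightedHomogeneousSubmodule, hS, ← Equiv.sum_comp σ]
  exact IsWeightedHomogeneous.prod _ _ _ fun m _ => genericUpper_isWeightedHomogeneous _ _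

theorem minorProduct_isWeightedHomogeneous {n k : ℕ} (C D : Diagram n k) (h : DiagramLE C D) :
    IsWeightedHomogeneous (rowGrading n) (minorProduct C D h) (rowWeight C) :=
  IsWeightedHomogeneous.prod _ _ _ fun _ _ => upperMinor_isWeightedHomogeneous _ _ _

/-- Set the variables at the positions (`m`-th row of `S`, `m`-th column of `R`) to 1 and the others
to 0. These positions are upper triangular because `S ≤ R`, and the submatrix becomes the identity.
-/
theorem upperMinor_ne_zero {n : ℕ} {R S : Finset (Fin n)} (h : SetLE S R) :
    upperMinor R S h.fst ≠ 0 := by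
  classical
  intro h0
  let v : {p : Fin n × Fin n // p.1 ≤ p.2} → ℂ := fun p =>
    if ∃ m, p.1 = (S.orderEmbOfFin h.fst m, R.orderEmbOfFin rfl m) then 1 else 0
  have h1 := congrArg (MvPolynomial.eval v) h0
  rw [upperMinor, RingHom.map_det, map_zero] at h1
  refine one_ne_zero (α := ℂ) (Eq.trans ?_ h1)
  rw [← Matrix.det_one (n := Fin R.card)]
  congr 1
  ext a b
  rw [Matrix.one_apply, RingHom.mapMatrix_apply, Matrix.map_apply, Matrix.submatrix_apply,
    genericUpper]
  split_ifs with hab hle hle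
  · subst hab
    rw [eval_X]
    exact (if_pos ⟨a, rfl⟩).symm
  · exact absurd (hab ▸ h.snd a) hle
  · rw [eval_X]
    refine (if_neg ?_).symm
    rintro ⟨m, hm⟩
    rw [Prod.mk.injEq, EmbeddingLike.apply_eq_iff_eq, EmbeddingLike.apply_eq_iff_eq] at hm
    exact hab (hm.1.trans hm.2.symm)
  · rw [map_zero]

theorem minorProduct_ne_zero {n k : ℕ} (C D : Diagram n k) (h : DiagramLE C D) :
    minorProduct C D h ≠ 0 :=
  Finset.prod_ne_zero_iff.2 fun j _ => upperMinor_ne_zero (h j)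

/-- The exponents of the dual character are the row weights of the diagrams `C ≤ D`. -/
theorem mem_support_dualCharacterPoly {n k : ℕ} (D : Diagram n k) (α : Fin n →₀ ℕ) :
    α ∈ (dualCharacterPoly D).support ↔ ∃ C, DiagramLE C D ∧ rowWeight C = α := by
  classical
  obtain ⟨b, hbs, hspan, hli⟩ := exists_linearIndependent ℂ
    {f | ∃ (C : Diagram n k) (h : DiagramLE C D), f = minorProduct C D h}
  have hgen : ∀ (C : Diagram n k) (h : DiagramLE C D),
      minorProduct C D h ∈ Submodule.span ℂ b :=
    fun C h => hspan ▸ Submodule.subset_span ⟨C, h, rfl⟩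
  have hfin : b.Finite := by
    refine Set.Finite.subset ?_ hbs
    refine (Set.finite_range fun C : Diagram n k =>
      if h : DiagramLE C D then minorProduct C D h else 0).subset ?_
    rintro f ⟨C, h, rfl⟩
    exact ⟨C, by simp [h]⟩
  have : Fintype b := hfin.fintype
  choose C hC hCeq using hbs
  let B : Module.Basis b ℂ (flaggedWeylModule D) :=
    (Module.Basis.span hli).map
      (LinearEquiv.ofEq _ _ (by rw [Subtype.range_coe]; exact hspan))
  have hB : ∀ v : b, ((B v : flaggedWeylModule D) : BorelRing n) = v := by
    intro v
    simp [B, Module.Basis.span_apply]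
  -- The torus is diagonal in a basis of minor products. The character is thus a sum of monomials
  -- with coefficient 1, and no cancellation can occur in its support.
  have hp : ∑ v : b, monomial (rowWeight (C v.2)) (1 : ℤ) = dualCharacterPoly D := by
    refine dualCharacterPoly_unique D _ fun x => ?_
    rw [dualCharacter, LinearMap.trace_eq_matrix_trace ℂ B, Matrix.trace, map_sum]
    refine Finset.sum_congr rfl fun v _ => ?_
    have hact : (borelAct (torusElt x⁻¹)).toLinearMap.restrict (flaggedWeylModule_stable D x) (B v)
        = (∏ j, ∏ i ∈ C v.2 j, (x i : ℂ)) • B v := by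
      apply Subtype.ext
      rw [Submodule.coe_smul, hB]
      change borelAct _ ((B v : flaggedWeylModule D) : BorelRing n) = _
      rw [hB]
      have h1 := minorProduct_act x (C v.2) D (hC v.2)
      rwa [← hCeq v.2] at h1
    rw [Matrix.diag_apply, LinearMap.toMatrix_apply, hact, rowWeight, monomial_sum_one]
    simp_rw [monomial_sum_one]
    simp [map_prod, aeval_monomial]
  have hcoeff : (dualCharacterPoly D).coeff α =
      ((Finset.univ.filter fun v : b => rowWeight (C v.2) = α).card : ℤ) := by
    rw [← hp, coeff_sum]
    simp [coeff_monomial]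
  rw [mem_support_iff, hcoeff, Nat.cast_ne_zero, Finset.card_ne_zero]
  constructor
  · rintro ⟨v, hv⟩
    exact ⟨_, hC v.2, (Finset.mem_filter.1 hv).2⟩
  · rintro ⟨E, hE, rfl⟩
    by_contra hempty
    rw [Finset.not_nonempty_iff_eq_empty, Finset.filter_eq_empty_iff] at hempty
    refine minorProduct_ne_zero E D hE ?_
    -- If no basis element had the weight of `E`, projection to that weight would kill the whole
    -- span, yet it fixes the nonzero product of `E`.
    have hker : Submodule.span ℂ b ≤
        LinearMap.ker (weightedHomogeneousComponent (R := ℂ) (rowGrading n) (rowWeight E)) := by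
      refine Submodule.span_le.2 fun f hf => ?_
      have hhom : IsWeightedHomogeneous (rowGrading n) f (rowWeight (C hf)) := by
        have := minorProduct_isWeightedHomogeneous (C hf) D (hC hf)
        rwa [← hCeq hf] at this
      exact hhom.weightedHomogeneousComponent_ne _ 
        (Ne.symm (hempty (Finset.mem_univ ⟨f, hf⟩)))
    have h1 := hker (hgen E hE)
    rwa [LinearMap.mem_ker,
      (minorProduct_isWeightedHomogeneous E D hE).weightedHomogeneousComponent_same] at h1

end

/-! ### Schubitopes as generalized permutahedra -/

/-- The sum of the rank functions of the Schubert matroids of the columns. -/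
noncomputable def diagramRank {n k : ℕ} (D : Diagram n k) : Finset (Fin n) → ℝ :=
  ∑ j, schubertRank (D j)

theorem diagramRank_apply {n k : ℕ} (D : Diagram n k) (I : Finset (Fin n)) :
    diagramRank D I = ∑ j, schubertRank (D j) I :=
  Finset.sum_apply _ _ _

/-- The polytope `{t : t(I) ≤ z(I), t([n]) = z([n])}`. -/
def basePolytope {n : ℕ} (z : Finset (Fin n) → ℝ) : Set (Fin n → ℝ) :=
  {t | (∀ I : Finset (Fin n), ∑ i ∈ I, t i ≤ z I) ∧ ∑ i, t i = z Finset.univ}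

/-- The exponent vector of a diagram as a point of `ℝⁿ`. -/
noncomputable def rowPoint {n k : ℕ} (C : Diagram n k) : Fin n → ℝ := fun i => (rowWeight C i : ℝ)

theorem sum_mul_rowPoint {n k : ℕ} (C : Diagram n k) (w : Fin n → ℝ) :
    ∑ i, w i * rowPoint C i = ∑ j, ∑ i ∈ C j, w i := by
  classical
  simp only [rowPoint, rowWeight_apply, Nat.cast_sum, Nat.cast_ite, Nat.cast_one, Nat.cast_zero,
    Finset.mul_sum]
  rw [Finset.sum_comm]
  simp

theorem sum_rowPoint {n k : ℕ} (C : Diagram n k) (I : Finset (Fin n)) :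
    ∑ i ∈ I, rowPoint C i = ∑ j, ((I ∩ C j).card : ℝ) := by
  classical
  simp only [rowPoint, rowWeight_apply, Nat.cast_sum, Nat.cast_ite, Nat.cast_one, Nat.cast_zero]
  rw [Finset.sum_comm]
  simp [Finset.sum_ite_mem]

theorem schubitope_eq_convexHull {n k : ℕ} (D : Diagram n k) :
    schubitope D = convexHull ℝ (rowPoint '' {C : Diagram n k | DiagramLE C D}) := by
  rw [schubitope, newtonPolytope]
  congr 1
  ext x
  constructor
  · rintro ⟨α, hα, rfl⟩
    obtain ⟨C, hC, rfl⟩ := (mem_support_dualCharacterPoly D α).1 hα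
    exact ⟨C, hC, rfl⟩
  · rintro ⟨C, hC, rfl⟩
    exact ⟨_, (mem_support_dualCharacterPoly D _).2 ⟨C, hC, rfl⟩, rfl⟩

theorem convex_basePolytope {n : ℕ} (z : Finset (Fin n) → ℝ) : Convex ℝ (basePolytope z) := by
  have h : ∀ (s t : Fin n → ℝ) (a b : ℝ) (I : Finset (Fin n)),
      ∑ i ∈ I, (a • s + b • t) i = a * ∑ i ∈ I, s i + b * ∑ i ∈ I, t i := by
    intro s t a b I
    simp [Finset.sum_add_distrib, Finset.mul_sum]
  rintro s ⟨hs, hs'⟩ t ⟨ht, ht'⟩ a b ha hb hab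
  refine ⟨fun I => ?_, ?_⟩
  · rw [h]
    calc _ ≤ a * z I + b * z I :=
          add_le_add (mul_le_mul_of_nonneg_left (hs I) ha) (mul_le_mul_of_nonneg_left (ht I) hb)
      _ = z I := by rw [← add_mul, hab, one_mul]
  · rw [h, hs', ht', ← add_mul, hab, one_mul]

theorem schubitope_subset_basePolytope {n k : ℕ} (D : Diagram n k) :
    schubitope D ⊆ basePolytope (diagramRank D) := by
  rw [schubitope_eq_convexHull]
  refine convexHull_min ?_ (convex_basePolytope _)
  rintro _ ⟨C, hC, rfl⟩
  refine ⟨fun I => ?_, ?_⟩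
  · rw [sum_rowPoint, diagramRank_apply]
    exact Finset.sum_le_sum fun j _ => card_inter_le_schubertRank (hC j) I
  · rw [sum_rowPoint, diagramRank_apply]
    refine Finset.sum_congr rfl fun j _ => ?_
    rw [Finset.univ_inter, schubertRank_univ, (hC j).fst]

/-- A base meeting `s` in a maximal independent set can be changed outside of `s` so as to meet
a larger set `t` in a maximal independent set as well. -/
theorem exists_setLE_inter_eq {n : ℕ} {I C s t : Finset (Fin n)} (hst : s ⊆ t) (hC : SetLE C I)
    (hs : ((s ∩ C).card : ℝ) = schubertRank I s) :
    ∃ C', SetLE C' I ∧ s ∩ C' = s ∩ C ∧ ((t ∩ C').card : ℝ) = schubertRank I t := by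
  classical
  have hE : (schubertMatroid n I).E = Set.univ := rfl
  have hind : (schubertMatroid n I).Indep ((s ∩ C : Finset (Fin n)) : Set (Fin n)) :=
    ((schubertMatroid_isBase_iff I C).2 hC).indep.subset
      (Finset.coe_subset.2 Finset.inter_subset_right)
  obtain ⟨B, hB, hsB⟩ := hind.subset_isBasis_of_subset (X := (t : Set (Fin n)))
    (Finset.coe_subset.2 (Finset.inter_subset_left.trans hst)) (by rw [hE]; exact Set.subset_univ _)
  obtain ⟨A, hA, hBA⟩ := hB.indep.exists_isBase_superset
  obtain ⟨C', rfl⟩ := A.toFinite.exists_finset_coe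
  obtain ⟨B', rfl⟩ := B.toFinite.exists_finset_coe
  have hC' := (schubertMatroid_isBase_iff I C').1 hA
  refine ⟨C', hC', Eq.symm ?_, le_antisymm (card_inter_le_schubertRank hC' t) ?_⟩
  -- `C'` contains `s ∩ C`, which already attains the rank of `s`, so `C'` has no further element in
  -- `s`.
  · refine Finset.eq_of_subset_of_card_le (fun x hx => ?_) ?_
    · exact Finset.mem_inter.2 ⟨(Finset.mem_inter.1 hx).1, hBA (hsB hx)⟩
    · have := card_inter_le_schubertRank hC' s
      rw [← hs] at this
      exact_mod_cast this
  · have h1 := hB.encard_eq_eRk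
    rw [← matroidRank_eq_eRk _ _ hE, Set.encard_coe_eq_coe_finsetCard, Nat.cast_inj] at h1
    rw [schubertRank, ← h1, Nat.cast_le]
    exact Finset.card_le_card fun x hx => Finset.mem_inter.2 ⟨hB.subset hx, hBA hx⟩

/-- The greedy algorithm. -/
theorem exists_diagramLE_greedy {n k : ℕ} (D : Diagram n k) (w t : Fin n → ℝ)
    (ht : ∀ I : Finset (Fin n), ∑ i ∈ I, t i ≤ diagramRank D I) (s : Finset (Fin n)) :
    ∃ C, DiagramLE C D ∧ (∀ j, ((s ∩ C j).card : ℝ) = schubertRank (D j) s) ∧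
      ∀ c, (∀ i ∈ s, c ≤ w i) →
        ∑ i ∈ s, (w i - c) * t i ≤ ∑ j, ∑ i ∈ s ∩ C j, (w i - c) := by
  classical
  -- Elements enter in order of decreasing weight. The free level `c` allows summation by parts: it
  -- is lowered to at most the weight of the new element at each step.
  induction s using Finset.induction_on_min_value w with
  | empty => exact ⟨D, fun j => setLE_refl _, fun j => by simp [schubertRank_apply_empty],
      fun c _ => by simp⟩
  | insert a s ha hmin ih =>
    obtain ⟨C, hC, hCs, hle⟩ := ih
    choose C' hC' hCC' hcard using fun j =>
      exists_setLE_inter_eq (Finset.subset_insert a s) (hC j) (hCs j)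
    refine ⟨C', hC', hcard, fun c hc => ?_⟩
    have hca : 0 ≤ w a - c := sub_nonneg.2 (hc a (Finset.mem_insert_self a s))
    -- At level `w a` the new element has coefficient 0 and the induction hypothesis applies. The
    -- remainder is `w a - c ≥ 0` times a total bounded by the rank.
    have hsplit : ∀ (u : Finset (Fin n)) (x : Fin n → ℝ), ∑ i ∈ u, (w i - c) * x i =
        ∑ i ∈ u, (w i - w a) * x i + (w a - c) * ∑ i ∈ u, x i := by
      intro u x
      rw [Finset.mul_sum, ← Finset.sum_add_distrib]
      exact Finset.sum_congr rfl fun i _ => by ring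
    have hR : ∀ j, ∑ i ∈ insert a s ∩ C' j, (w i - c) =
        ∑ i ∈ s ∩ C j, (w i - w a) + (w a - c) * schubertRank (D j) (insert a s) := by
      intro j
      have h1 := hsplit (insert a s ∩ C' j) 1
      simp only [Pi.one_apply, mul_one, Finset.sum_const, nsmul_eq_mul] at h1
      rw [h1, hcard, ← hCC']
      congr 1
      by_cases haC : a ∈ C' j
      · rw [Finset.insert_inter_of_mem haC, Finset.sum_insert (by simp [ha]), sub_self, zero_add]
      · rw [Finset.insert_inter_of_notMem haC]
    rw [hsplit, Finset.sum_insert ha, sub_self, zero_mul, zero_add]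
    simp only [hR, Finset.sum_add_distrib, ← Finset.mul_sum, ← diagramRank_apply]
    exact add_le_add (hle _ hmin) (mul_le_mul_of_nonneg_left (ht _) hca)

/-- The Schubitope is the polytope of the sum of the rank functions of the columns. -/
theorem schubitope_eq_basePolytope {n k : ℕ} (D : Diagram n k) :
    schubitope D = basePolytope (diagramRank D) := by
  classical
  refine (schubitope_subset_basePolytope D).antisymm fun t ht => ?_
  by_contra hmem
  have hclosed : IsClosed (schubitope D) := by
    rw [schubitope_eq_convexHull]
    exact ((Set.toFinite _).image _).isClosed_convexHull ℝ
  have hconv : Convex ℝ (schubitope D) := convex_convexHull ℝ _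
  -- A functional separating `t` from the Schubitope is contradicted by the greedy vertex, on which
  -- its value is at least that at `t`.
  obtain ⟨f, u, hf, hu⟩ := geometric_hahn_banach_closed_point hconv hclosed hmem
  let w : Fin n → ℝ := fun i => f (Pi.single i 1)
  have hfw : ∀ x : Fin n → ℝ, f x = ∑ i, w i * x i := by
    intro x
    conv_lhs => rw [pi_eq_sum_univ' x, map_sum]
    refine Finset.sum_congr rfl fun i _ => ?_
    rw [map_smul, smul_eq_mul, mul_comm]
  obtain ⟨C, hC, hcard, hle⟩ := exists_diagramLE_greedy D w t ht.1 Finset.univ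
  -- Any lower bound of the weights will do: the terms in `c` cancel because `t` and the vertex have
  -- the same coordinate sum.
  obtain ⟨c, hc⟩ := (Set.finite_range w).bddBelow
  have h1 := hle c fun i _ => hc ⟨i, rfl⟩
  have h2 := hf (rowPoint C) (by
    rw [schubitope_eq_convexHull]
    exact subset_convexHull ℝ _ ⟨C, hC, rfl⟩)
  simp only [Finset.univ_inter] at h1 hcard
  simp only [sub_mul, Finset.sum_sub_distrib, ← Finset.mul_sum, Finset.sum_const, nsmul_eq_mul,
    ← Finset.sum_mul, hcard, ← diagramRank_apply] at h1
  rw [ht.2, ← hfw, ← sum_mul_rowPoint, ← hfw, mul_comm c] at h1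
  linarith

/-- For submodular `z`, a point of the polytope of `z` on the ground set `I` extends to a point of
the polytope on `I ∪ s`. -/
theorem exists_sum_eq_of_isSubmodular {n : ℕ} {z : Finset (Fin n) → ℝ} (hz : IsSubmodular z)
    {I : Finset (Fin n)} {v : Fin n → ℝ} (hv : ∀ J ⊆ I, ∑ i ∈ J, v i ≤ z J)
    (hvI : ∑ i ∈ I, v i = z I) (s : Finset (Fin n)) :
    ∃ v' : Fin n → ℝ, (∀ J ⊆ I ∪ s, ∑ i ∈ J, v' i ≤ z J) ∧ ∑ i ∈ I ∪ s, v' i = z (I ∪ s) ∧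
      ∑ i ∈ I, v' i = z I := by
  classical
  induction s using Finset.induction_on with
  | empty => exact ⟨v, by simpa using hv, by simpa using hvI, hvI⟩
  | insert a s _ ih =>
    obtain ⟨v', h1, h2, h3⟩ := ih
    rw [Finset.union_insert]
    by_cases ha : a ∈ I ∪ s
    · rw [Finset.insert_eq_of_mem ha]
      exact ⟨v', h1, h2, h3⟩
    · have hupd : ∀ J : Finset (Fin n), a ∉ J → ∀ y,
          ∑ i ∈ J, Function.update v' a y i = ∑ i ∈ J, v' i := fun J hJ y =>
        Finset.sum_congr rfl fun i hi => Function.update_of_ne (fun he => hJ (by rwa [← he])) _ _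
      -- This value is forced by tightness on the enlarged set. For `J` containing `a`,
      -- submodularity at `J` and `I ∪ s` gives the bound.
      refine ⟨Function.update v' a (z (insert a (I ∪ s)) - z (I ∪ s)), fun J hJ => ?_, ?_, ?_⟩
      · by_cases haJ : a ∈ J
        · have hsub : J.erase a ⊆ I ∪ s := fun x hx =>
            (Finset.mem_insert.1 (hJ (Finset.mem_of_mem_erase hx))).resolve_left
              (Finset.ne_of_mem_erase hx)
          have h4 := hz J (I ∪ s)
          have hun : J ∪ (I ∪ s) = insert a (I ∪ s) := by
            refine Finset.Subset.antisymm (Finset.union_subset hJ (Finset.subset_insert _ _)) ?_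
            exact Finset.insert_subset (Finset.mem_union_left _ haJ) Finset.subset_union_right
          have hin : J ∩ (I ∪ s) = J.erase a := by
            conv_lhs => rw [← Finset.insert_erase haJ]
            rw [Finset.insert_inter_of_notMem ha, Finset.inter_eq_left.2 hsub]
          rw [hun, hin] at h4
          rw [← Finset.add_sum_erase _ _ haJ, Function.update_self,
            hupd _ (Finset.notMem_erase a J)]
          linarith [h1 _ hsub]
        · rw [hupd J haJ]
          exact h1 J fun x hx => (Finset.mem_insert.1 (hJ hx)).resolve_left
            (fun he => haJ (he ▸ hx))
      · rw [Finset.sum_insert ha, Function.update_self, hupd _ ha, h2]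
        ring
      · rw [hupd I fun h => ha (Finset.mem_union_left _ h), h3]

/-- Two extensions, from `∅` to `I` and from `I` to `[n]`; the second preserves tightness on `I`. -/
theorem exists_mem_basePolytope_sum_eq {n : ℕ} {z : Finset (Fin n) → ℝ} (hz : IsSubmodular z)
    (h0 : z ∅ = 0) (I : Finset (Fin n)) : ∃ v ∈ basePolytope z, ∑ i ∈ I, v i = z I := by
  obtain ⟨v, h1, h2, -⟩ := exists_sum_eq_of_isSubmodular hz (I := ∅) (v := 0)
    (fun J hJ => by simp [Finset.subset_empty.1 hJ, h0]) (by simp [h0]) I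
  rw [Finset.empty_union] at h1 h2
  obtain ⟨v', h3, h4, h5⟩ := exists_sum_eq_of_isSubmodular hz h1 h2 Finset.univ
  rw [Finset.union_eq_right.2 (Finset.subset_univ I)] at h3 h4
  exact ⟨v', ⟨fun J => h3 J (Finset.subset_univ J), h4⟩, h5⟩

/-- A base optimal for `I` can be chosen in each column independently. -/
theorem exists_mem_schubitope_sum_eq {n k : ℕ} (D : Diagram n k) (I : Finset (Fin n)) :
    ∃ v ∈ schubitope D, ∑ i ∈ I, v i = diagramRank D I := by
  choose C hC h using fun j => exists_card_inter_eq_schubertRank (D j) I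
  refine ⟨rowPoint C, ?_, ?_⟩
  · rw [schubitope_eq_convexHull]
    exact subset_convexHull ℝ _ ⟨C, hC, rfl⟩
  · rw [sum_rowPoint, diagramRank_apply]
    exact Finset.sum_congr rfl fun j _ => h j

/-- Two set functions whose values are attained on a common polytope agree. -/
theorem eq_of_basePolytope_eq {n : ℕ} {z z' : Finset (Fin n) → ℝ}
    (hz : ∀ I, ∃ v ∈ basePolytope z, ∑ i ∈ I, v i = z I)
    (hz' : ∀ I, ∃ v ∈ basePolytope z', ∑ i ∈ I, v i = z' I)
    (h : basePolytope z = basePolytope z') : z = z' := by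
  ext I
  refine le_antisymm ?_ ?_
  · obtain ⟨v, hv, hvI⟩ := hz I
    exact hvI ▸ (h ▸ hv : v ∈ basePolytope z').1 I
  · obtain ⟨v, hv, hvI⟩ := hz' I
    exact hvI ▸ (h ▸ hv : v ∈ basePolytope z).1 I

theorem exists_mem_basePolytope_diagramRank {n k : ℕ} (D : Diagram n k) (I : Finset (Fin n)) :
    ∃ v ∈ basePolytope (diagramRank D), ∑ i ∈ I, v i = diagramRank D I :=
  schubitope_eq_basePolytope D ▸ exists_mem_schubitope_sum_eq D I

theorem schubitope_eq_iff_diagramRank_eq {n k k' : ℕ} (D : Diagram n k) (D' : Diagram n k') :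
    schubitope D = schubitope D' ↔ diagramRank D = diagramRank D' := by
  rw [schubitope_eq_basePolytope, schubitope_eq_basePolytope]
  exact ⟨eq_of_basePolytope_eq (exists_mem_basePolytope_diagramRank D)
    (exists_mem_basePolytope_diagramRank D'), fun h => by rw [h]⟩

/-! ### Multiplicities of columns -/

/-- The number of columns equal to `I`. -/
def columnCount {n k : ℕ} (D : Diagram n k) (I : Finset (Fin n)) : ℕ :=
  Fintype.card {j // D j = I}

theorem diagramRank_eq_sum_columnCount {n k : ℕ} (D : Diagram n k) :
    diagramRank D =
      ∑ I : {I : Finset (Fin n) // I.Nonempty}, columnCount D I.1 • schubertRank I.1 := by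
  classical
  have h1 : diagramRank D = ∑ I : Finset (Fin n), columnCount D I • schubertRank I := by
    rw [diagramRank, ← Finset.sum_fiberwise_of_maps_to (t := Finset.univ) (g := D)
      fun _ _ => Finset.mem_univ _]
    refine Finset.sum_congr rfl fun I _ => ?_
    rw [Finset.sum_congr rfl fun j hj => congrArg schubertRank (Finset.mem_filter.1 hj).2,
      Finset.sum_const, columnCount, Fintype.card_subtype]
  rw [h1, ← Finset.sum_subtype (Finset.univ.filter Finset.Nonempty) (by simp)
    fun I => columnCount D I • schubertRank I]
  -- Empty columns have zero rank function, so they are invisible to the Schubitope.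
  refine (Finset.sum_filter_of_ne fun I _ hI => ?_).symm
  rw [Finset.nonempty_iff_ne_empty]
  rintro rfl
  exact hI (by rw [schubertRank_empty, smul_zero])

theorem diagramRank_eq_iff_columnCount_eq {n k k' : ℕ} (D : Diagram n k) (D' : Diagram n k') :
    diagramRank D = diagramRank D' ↔
      ∀ I : Finset (Fin n), I.Nonempty → columnCount D I = columnCount D' I := by
  rw [diagramRank_eq_sum_columnCount, diagramRank_eq_sum_columnCount]
  constructor
  · intro h I hI
    have h1 := Fintype.linearIndependent_iff.1 (linearIndependent_schubertRank n)
      (fun I => (columnCount D I.1 : ℝ) - columnCount D' I.1) (by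
        simp only [sub_smul, Finset.sum_sub_distrib, Nat.cast_smul_eq_nsmul, h, sub_self]) ⟨I, hI⟩
    exact_mod_cast sub_eq_zero.1 h1
  · exact fun h => Finset.sum_congr rfl fun I _ => by rw [h I.1 I.2]

/-- The bijection is glued from bijections between the fibres over each column set; the fibres over
`∅` are empty. -/
theorem columnCount_eq_iff_exists_equiv {n k k' : ℕ} (D : Diagram n k) (D' : Diagram n k') :
    (∀ I : Finset (Fin n), I.Nonempty → columnCount D I = columnCount D' I) ↔
      ∃ e : {j // (D j).Nonempty} ≃ {j // (D' j).Nonempty}, ∀ j, D j.1 = D' (e j).1 := by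
  have hsub : ∀ {l : ℕ} (E : Diagram n l) (I : Finset (Fin n)), I.Nonempty →
      Nonempty ({j : {j // (E j).Nonempty} // E j.1 = I} ≃ {j // E j = I}) := fun E I hI =>
    ⟨(Equiv.subtypeSubtypeEquivSubtype fun {j} (h : E j = I) => h ▸ hI)⟩
  constructor
  · intro h
    have hfib : ∀ I : Finset (Fin n),
        Nonempty ({j : {j // (D j).Nonempty} // D j.1 = I} ≃
          {j : {j // (D' j).Nonempty} // D' j.1 = I}) := by
      intro I
      rcases I.eq_empty_or_nonempty with rfl | hI
      · have h1 : IsEmpty {j : {j // (D j).Nonempty} // D j.1 = ∅} :=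
          ⟨fun j => j.1.2.ne_empty j.2⟩
        have h2 : IsEmpty {j : {j // (D' j).Nonempty} // D' j.1 = ∅} :=
          ⟨fun j => j.1.2.ne_empty j.2⟩
        exact ⟨Equiv.equivOfIsEmpty _ _⟩
      · obtain ⟨e⟩ := hsub D I hI
        obtain ⟨e'⟩ := hsub D' I hI
        exact ⟨e.trans ((Fintype.equivOfCardEq (h I hI)).trans e'.symm)⟩
    exact ⟨Equiv.ofFiberEquiv fun I => (hfib I).some,
      fun j => (Equiv.ofFiberEquiv_map (f := fun j : {j // (D j).Nonempty} => D j.1)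
        (g := fun j : {j // (D' j).Nonempty} => D' j.1) _ j).symm⟩
  · rintro ⟨e, he⟩ I hI
    obtain ⟨f⟩ := hsub D I hI
    obtain ⟨f'⟩ := hsub D' I hI
    exact Fintype.card_congr (f.symm.trans
      ((e.subtypeEquiv fun j => by rw [he]).trans f'))

/-- With equal widths, a matching of the nonempty columns leaves equally many empty ones, so it
extends to a permutation. -/
theorem exists_perm_iff_exists_equiv_nonempty {n k : ℕ} (D D' : Diagram n k) :
    (∃ σ : Equiv.Perm (Fin k), ∀ j, D j = D' (σ j)) ↔
      ∃ e : {j // (D j).Nonempty} ≃ {j // (D' j).Nonempty}, ∀ j, D j.1 = D' (e j).1 := by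
  constructor
  · rintro ⟨σ, hσ⟩
    exact ⟨σ.subtypeEquiv fun j => by rw [hσ], fun j => hσ j.1⟩
  · rintro ⟨e, he⟩
    refine ⟨e.extendSubtype, fun j => ?_⟩
    by_cases hj : (D j).Nonempty
    · rw [e.extendSubtype_apply_of_mem j hj]
      exact he ⟨j, hj⟩
    · rw [Finset.not_nonempty_iff_eq_empty.1 hj,
        Finset.not_nonempty_iff_eq_empty.1 (e.extendSubtype_not_mem j hj)]

/-! ### Equality and recognition of Schubitopes -/

theorem schubitope_eq_iff {n k k' : ℕ} (D : Diagram n k) (D' : Diagram n k') :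
    schubitope D = schubitope D' ↔
      ∃ e : {j // (D j).Nonempty} ≃ {j // (D' j).Nonempty}, ∀ j, D j.1 = D' (e j).1 := by
  rw [schubitope_eq_iff_diagramRank_eq, diagramRank_eq_iff_columnCount_eq,
    columnCount_eq_iff_exists_equiv]

/-- Every multiset of columns is realized by a diagram. -/
theorem exists_diagram_diagramRank_eq {n : ℕ} (c : {I : Finset (Fin n) // I.Nonempty} → ℕ) :
    ∃ (k : ℕ) (D : Diagram n k), diagramRank D = ∑ I, c I • schubertRank I.1 := by
  classical
  -- The columns enumerate `c I` copies of each `I`.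
  let e := Fintype.equivFin (Σ I : {I : Finset (Fin n) // I.Nonempty}, Fin (c I))
  refine ⟨_, fun j => (e.symm j).1.1, ?_⟩
  rw [diagramRank, Equiv.sum_comp e.symm fun x => schubertRank x.1.1, Fintype.sum_sigma]
  simp

theorem isSchubitope_iff {n : ℕ} {P : Set (Fin n → ℝ)} {z : Finset (Fin n) → ℝ}
    (h : IsGeneralizedPermutahedronOf P z) :
    IsSchubitope P ↔
      ∃ c : {I : Finset (Fin n) // I.Nonempty} → ℕ, z = ∑ I, c I • schubertRank I.1 := by
  obtain ⟨hz, h0, hP⟩ := h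
  change P = basePolytope z at hP
  subst hP
  constructor
  · rintro ⟨k, D, hD⟩
    refine ⟨fun I => columnCount D I.1, ?_⟩
    rw [← diagramRank_eq_sum_columnCount]
    rw [schubitope_eq_basePolytope] at hD
    -- Both functions attain all their bounds on the common polytope; for `z` this is where
    -- submodularity enters.
    exact eq_of_basePolytope_eq (exists_mem_basePolytope_sum_eq hz h0)
      (exists_mem_basePolytope_diagramRank D) hD
  · rintro ⟨c, rfl⟩
    obtain ⟨k, D, hD⟩ := exists_diagram_diagramRank_eq c
    exact ⟨k, D, by rw [schubitope_eq_basePolytope, hD]⟩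

end SchubitopeTheory

theorem theorem1p4 (n : ℕ) (hn : 1 ≤ n) :
    -- the rank functions, indexed by the nonempty subsets of `[n]`, form a basis
    (∃ b : Module.Basis {I : Finset (Fin n) // I.Nonempty} ℝ (pointedSetFunctions n),
      ∀ I, (b I : Finset (Fin n) → ℝ) = schubertRank I.1) ∧
    -- Schubitopes among generalized permutahedra
    (∀ (P : Set (Fin n → ℝ)) (z : Finset (Fin n) → ℝ), IsGeneralizedPermutahedronOf P z →
      (IsSchubitope P ↔
        ∃ c : {I : Finset (Fin n) // I.Nonempty} → ℕ, z = ∑ I, c I • schubertRank I.1)) ∧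
    -- equality of Schubitopes of diagrams in the same grid
    (∀ (k : ℕ) (D D' : Diagram n k),
      schubitope D = schubitope D' ↔ ∃ σ : Equiv.Perm (Fin k), ∀ j, D j = D' (σ j)) ∧
    -- equality of Schubitopes of diagrams in grids of different widths, up to empty columns
    (∀ (k k' : ℕ) (D : Diagram n k) (D' : Diagram n k'),
      schubitope D = schubitope D' ↔
        ∃ e : {j // (D j).Nonempty} ≃ {j // (D' j).Nonempty}, ∀ j, D j.1 = D' (e j).1) := by
  exact ⟨exists_basis_schubertRank n, fun P z h => isSchubitope_iff h,
    fun k D D' => (schubitope_eq_iff D D').trans (exists_perm_iff_exists_equiv_nonempty D D').symm,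
    fun k k' D D' => schubitope_eq_iff D D'⟩
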